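/- Let $\mathbb T=\mathbb R/\mathbb Z$ and let $n\ge 1$ be an integer. A \emph{kernel function} is a function $K:(-1,0)\cup(0,1)\to\mathbb R$ that is concave on $(-1,0)$ and on $(0,1)$ and satisfies $\lim_{t\downarrow 0}K(t)=\lim_{t\uparrow 0}K(t)$ in $\mathbb R\cup\{-\infty\}$; it is extended to $[-1,1]$, with values in $\mathbb R\cup\{-\infty\}$, by its limits at $-1,0,1$. It is \emph{singular} if $K(0)=-\infty$, \emph{strictly concave} if it is strictly concave on $(-1,0)$ and on $(0,1)$, and \emph{periodic} if $K(t-1)=K(t)$ for $t\in(0,1)$, in which case it is regarded as a function on $\mathbb T$. An \emph{$n$-field function} is a function $J:\mathbb T\to\mathbb R\cup\{-\infty\}$ that is bounded above and is finite at more than $n$ points of $\mathbb T$. Let $L\subset\mathbb T^n$ (respectively $\overline L\subset\mathbb T^n$) be the set of all $\mathbf y=(y_1,\dots,y_n)$ for which there are real numbers $x_j$ with $y_j=x_j \bmod 1$ and $x_1<x_2<\dots<x_n<x_1+1$ (respectively $x_1\le x_2\le\dots\le x_n\le x_1+1$). Let $\nu_1,\dots,\nu_n>0$, let $K$ be a singular,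 strictly concave, periodic kernel function, and let $J$ be an arbitrary $n$-field function. For $\mathbf y\in\overline L$ and $t\in\mathbb T$ put $$F(\mathbf y,t)=J(t)+\sum_{j=1}^n\nu_jK(t-y_j),\qquad \overline m^*(\mathbf y)=\sup_{t\in\mathbb T}F(\mathbf y,t),\qquad m_j^*(\mathbf y)=\sup_{t\in I_j^*(\mathbf y)}F(\mathbf y,t),$$ where, with $y_{n+1}:=y_1$, $I_j^*(\mathbf y)$ is the closed arc leading counterclockwise from $y_j$ to $y_{j+1}$; it is $\{y_j\}$ if $y_j=y_{j+1}$, except that $I_n^*(\mathbf y)=\mathbb T$ if all the nodes coincide (in particular if $n=1$). Then there is a point $\mathbf w\in\overline L$ with $\overline m^*(\mathbf w)=\inf_{\mathbf y\in\overline L}\overline m^*(\mathbf y)$ (a minimax point). Moreover, every minimax point $\mathbf w\in\overline L$ belongs to $L$ and is an equioscillation point, i.e. $m_1^*(\mathbf w)=m_2^*(\mathbf w)=\dots=m_n^*(\mathbf w)$. -/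

import Mathlib

open Set Filter Topology

noncomputable section

namespace SumOfTranslates

/-- The domain `(-1,0) ∪ (0,1)` of a kernel function. A kernel function is represented by a
function `K : ℝ → ℝ` of which only the values on this set are ever used. -/
def kernelDomain : Set ℝ := Ioo (-1) 0 ∪ Ioo 0 1

/-- `K` is a kernel function: concave on `(-1,0)` and on `(0,1)`, and the one-sided limits at `0`
(in the extended reals) agree. -/
structure IsKernel (K : ℝ → ℝ) : Prop where
  concave_neg : ConcaveOn ℝ (Ioo (-1) 0) K
  concave_pos : ConcaveOn ℝ (Ioo 0 1) K
  limits_agree : ∃ l : EReal, Tendsto (fun t => (K t : EReal)) (𝓝[>] 0) (𝓝 l) ∧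
    Tendsto (fun t => (K t : EReal)) (𝓝[<] 0) (𝓝 l)

open Classical in
/-- The extension of a kernel function to `[-1,1]` by its limits at `-1`, `0` and `1`, with values
in `ℝ ∪ {-∞}`. -/
def extendKernel (K : ℝ → ℝ) (t : ℝ) : EReal :=
  if t ∈ kernelDomain then (K t : EReal)
  else limUnder (𝓝[kernelDomain] t) (fun s => (K s : EReal))

/-- The kernel function is singular: `K(0) = -∞`. -/
def IsSingular (K : ℝ → ℝ) : Prop := extendKernel K 0 = ⊥

/-- The kernel function is strictly concave on both of the intervals `(-1,0)` and `(0,1)`. -/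
def IsStrictlyConcave (K : ℝ → ℝ) : Prop :=
  StrictConcaveOn ℝ (Ioo (-1) 0) K ∧ StrictConcaveOn ℝ (Ioo 0 1) K

/-- The kernel function is `1`-periodic: `K(t - 1) = K(t)`. -/
def IsPeriodicKernel (K : ℝ → ℝ) : Prop := ∀ t ∈ Ioo (0 : ℝ) 1, K (t - 1) = K t

/-- The representative in `[0,1)` of a point of the torus `ℝ / ℤ`. -/
def rep (x : UnitAddCircle) : ℝ := (AddCircle.equivIco 1 0 x : ℝ)

/-- A periodic kernel function as a function on the torus. -/
def torusKernel (K : ℝ → ℝ) (x : UnitAddCircle) : EReal := extendKernel K (rep x)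

/-- `J` is an `n`-field function on the torus: bounded above (so with values in `ℝ ∪ {-∞}`), and
finite at more than `n` points. -/
structure IsField (n : ℕ) (J : UnitAddCircle → EReal) : Prop where
  bddAbove : ∃ C : ℝ, ∀ t, J t ≤ (C : EReal)
  finite_at : (n : ℕ∞) < {t | J t ≠ ⊥}.encard

/-- The open cyclic simplex `L`: node systems `y₁ ≺ y₂ ≺ … ≺ yₙ (≺ y₁)`, that is, systems whose
nodes are passed strictly in this order when the circle is covered once counterclockwise from
`y₁` back to `y₁`. -/
def openSimplex (n : ℕ) : Set (Fin n → UnitAddCircle) :=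
  {y | ∃ x : Fin n → ℝ, (∀ j, (x j : UnitAddCircle) = y j) ∧ StrictMono x ∧
    ∀ i j, x j < x i + 1}

/-- The closed cyclic simplex: node systems `y₁ ≼ y₂ ≼ … ≼ yₙ (≼ y₁)`. -/
def closedSimplex (n : ℕ) : Set (Fin n → UnitAddCircle) :=
  {y | ∃ x : Fin n → ℝ, (∀ j, (x j : UnitAddCircle) = y j) ∧ Monotone x ∧
    ∀ i j, x j ≤ x i + 1}

/-- The sum of translates function `F(y,t) = J(t) + ∑ⱼ νⱼ K(t - yⱼ)` on the torus. -/
def sumTranslates {n : ℕ} (ν : Fin n → ℝ) (K : ℝ → ℝ) (J : UnitAddCircle → EReal)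
    (y : Fin n → UnitAddCircle) (t : UnitAddCircle) : EReal :=
  J t + ∑ j, (ν j : EReal) * torusKernel K (t - y j)

/-- The closed arc of the torus that leads counterclockwise from `a` to `b`; it is `{a}` when
`a = b`. -/
def ccwArc (a b : UnitAddCircle) : Set UnitAddCircle := {t | rep (t - a) ≤ rep (b - a)}

open Classical in
/-- The arc from the node `yⱼ` to the cyclically next node (`j + 1` is taken modulo `n`). When all
nodes coincide (in particular for `n = 1`), the last arc is the whole torus. -/
def arc {n : ℕ} [NeZero n] (y : Fin n → UnitAddCircle) (j : Fin n) : Set UnitAddCircle :=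
  if (∀ i, y i = y j) ∧ (j : ℕ) + 1 = n then univ else ccwArc (y j) (y (j + 1))

/-- The arc maximum (in fact, supremum) of the sum of translates function on the `j`-th arc. -/
def arcMax {n : ℕ} [NeZero n] (ν : Fin n → ℝ) (K : ℝ → ℝ) (J : UnitAddCircle → EReal)
    (y : Fin n → UnitAddCircle) (j : Fin n) : EReal :=
  ⨆ t ∈ arc y j, sumTranslates ν K J y t

/-- The supremum of the sum of translates function over the torus. -/
def torusMax {n : ℕ} (ν : Fin n → ℝ) (K : ℝ → ℝ) (J : UnitAddCircle → EReal)
    (y : Fin n → UnitAddCircle) : EReal :=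
  ⨆ t, sumTranslates ν K J y t

/-- The minimax value over the closed cyclic simplex. -/
def minimaxValue {n : ℕ} (ν : Fin n → ℝ) (K : ℝ → ℝ) (J : UnitAddCircle → EReal) : EReal :=
  ⨅ y ∈ closedSimplex n, torusMax ν K J y

/-- `w` is a minimax point: it lies in the closed cyclic simplex and attains the minimax value. -/
def IsMinimaxPoint {n : ℕ} (ν : Fin n → ℝ) (K : ℝ → ℝ) (J : UnitAddCircle → EReal)
    (w : Fin n → UnitAddCircle) : Prop :=
  w ∈ closedSimplex n ∧ torusMax ν K J w = minimaxValue ν K J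

/-- `w` is an equioscillation point: all arc maxima are equal. -/
def IsEquioscillationPoint {n : ℕ} [NeZero n] (ν : Fin n → ℝ) (K : ℝ → ℝ)
    (J : UnitAddCircle → EReal) (w : Fin n → UnitAddCircle) : Prop :=
  ∀ i j, arcMax ν K J w i = arcMax ν K J w j

end SumOfTranslates

end

/-! Everything is exponentiated: exp F becomes the product of exp J and the real function
`kernelProd`. Singularity and periodicity make exp K continuous on the torus with value 0 at 0, so
`kernelProd` is jointly continuous in nodes and point and vanishes exactly at the nodes. For fixed
t, F is continuous in the nodes however irregular J is. The supremum over t is therefore lower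
semicontinuous and attains its minimum on the compact closed simplex.

The core is a perturbation argument. Suppose that at a minimax point the supremum over one arc is
strictly below the total supremum. Cut the circle along that arc and push the two clusters of nodes
at its ends away from it, by distances inversely proportional to their weights. On the other side,
strict concavity makes `kernelProd` strictly smaller (`kernelProd_clampNodes_lt`); on the chosen arc
it may grow, but by continuity only slightly. Since J is bounded above, a small move lowers the
total supremum (`exists_closedSimplex_bound_lt`), contradicting minimality. So every arc supremum
equals the total one.

The total supremum is not -∞, because J is finite at some point off the nodes. A degenerate arc
consists of one node, where F = -∞. Hence a minimax point has no degenerate arc and lies in the open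
simplex. -/

namespace SumOfTranslates

/-! ### Real exponentials of extended reals -/

/-- The real-valued exponential of an extended real number. -/
noncomputable def rexp (x : EReal) : ℝ := (EReal.exp x).toReal

lemma rexp_nonneg (x : EReal) : 0 ≤ rexp x := ENNReal.toReal_nonneg

lemma rexp_coe (x : ℝ) : rexp x = Real.exp x := by
  simp [rexp, Real.exp_nonneg]

lemma rexp_bot : rexp ⊥ = 0 := by simp [rexp]

lemma rexp_add (x y : EReal) : rexp (x + y) = rexp x * rexp y := by
  simp [rexp, EReal.exp_add]

lemma rexp_sum {ι : Type*} (s : Finset ι) (f : ι → EReal) :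
    rexp (∑ i ∈ s, f i) = ∏ i ∈ s, rexp (f i) := by
  classical
  induction s using Finset.induction_on with
  | empty => simp [rexp]
  | insert a s ha ih => rw [Finset.sum_insert ha, Finset.prod_insert ha, rexp_add, ih]

lemma rexp_coe_mul (a : ℝ) (x : EReal) : rexp (a * x) = rexp x ^ a := by
  rw [rexp, mul_comm, EReal.exp_mul, rexp, ENNReal.toReal_rpow]

/-- The value ⊤ must be excluded because `toReal` sends it to 0. -/
lemma rexp_le_exp_iff {x : EReal} (hx : x ≠ ⊤) (c : ℝ) : rexp x ≤ Real.exp c ↔ x ≤ c := by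
  rw [← EReal.exp_le_exp_iff, EReal.exp_coe, rexp,
    ENNReal.le_ofReal_iff_toReal_le (by simpa using hx) (Real.exp_nonneg c)]

lemma log_ofReal_rexp {x : EReal} (hx : x ≠ ⊤) : ENNReal.log (ENNReal.ofReal (rexp x)) = x := by
  rw [rexp, ENNReal.ofReal_toReal (by simpa using hx), EReal.log_exp]

/-! ### The exponentiated kernel on the torus -/

section Kernel

variable {K : ℝ → ℝ}

lemma tendsto_kernel_zero (hK : IsKernel K) (hsing : IsSingular K) :
    Tendsto (fun t => (K t : EReal)) (𝓝[>] 0) (𝓝 ⊥) ∧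
      Tendsto (fun t => (K t : EReal)) (𝓝[<] 0) (𝓝 ⊥) := by
  obtain ⟨l, hr, hl⟩ := hK.limits_agree
  have hle : 𝓝[kernelDomain] (0 : ℝ) ≤ 𝓝[<] 0 ⊔ 𝓝[>] 0 := by
    rw [← nhdsWithin_union]
    refine nhdsWithin_mono _ ?_
    rintro t (ht | ht)
    · exact Or.inl ht.2
    · exact Or.inr ht.1
  have hne : (𝓝[kernelDomain] (0 : ℝ)).NeBot := by
    have h1 : (𝓝[Ioo 0 1] (0 : ℝ)).NeBot := by
      rw [nhdsWithin_Ioo_eq_nhdsGT (by norm_num)]; infer_instance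
    exact h1.mono (nhdsWithin_mono _ subset_union_right)
  have hlim : Tendsto (fun t => (K t : EReal)) (𝓝[kernelDomain] 0) (𝓝 l) :=
    (hl.sup hr).mono_left hle
  have h0 : (0 : ℝ) ∉ kernelDomain := by simp [kernelDomain]
  have : l = ⊥ := by
    rw [← hsing, extendKernel, if_neg h0, hlim.limUnder_eq]
  subst this
  exact ⟨hr, hl⟩

/-- The exponential of a kernel function on `[0,1]`, with value `0` at the end points. -/
noncomputable def expKernelIcc (K : ℝ → ℝ) : ℝ → ℝ := (Ioo 0 1).indicator fun s => Real.exp (K s)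

lemma expKernelIcc_of_mem {s : ℝ} (hs : s ∈ Ioo (0 : ℝ) 1) : expKernelIcc K s = Real.exp (K s) :=
  indicator_of_mem hs _

lemma expKernelIcc_of_notMem {s : ℝ} (hs : s ∉ Ioo (0 : ℝ) 1) : expKernelIcc K s = 0 :=
  indicator_of_notMem hs _

lemma tendsto_exp_of_tendsto_bot {l : Filter ℝ} (h : Tendsto (fun t => (K t : EReal)) l (𝓝 ⊥)) :
    Tendsto (fun t => Real.exp (K t)) l (𝓝 0) := by
  apply Real.tendsto_exp_atBot.comp
  rw [tendsto_atBot]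
  intro b
  have := h.eventually (Iio_mem_nhds (EReal.bot_lt_coe b))
  filter_upwards [this] with t ht
  exact (EReal.coe_lt_coe_iff.1 ht).le

/-- Concavity gives continuity inside. At 0 the limit is singularity itself; at 1 periodicity
transports the left limit at 0. -/
lemma continuousOn_expKernelIcc (hK : IsKernel K) (hsing : IsSingular K)
    (hper : IsPeriodicKernel K) : ContinuousOn (expKernelIcc K) (Icc 0 1) := by
  obtain ⟨hr, hl⟩ := tendsto_kernel_zero hK hsing
  have hl' : Tendsto (fun t => (K t : EReal)) (𝓝[Ioo 0 1] 1) (𝓝 ⊥) := by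
    have hshift : Tendsto (fun t : ℝ => t - 1) (𝓝[Ioo 0 1] 1) (𝓝[<] 0) := by
      refine tendsto_nhdsWithin_of_tendsto_nhds_of_eventually_within _ ?_ ?_
      · have : Tendsto (fun t : ℝ => t - 1) (𝓝 1) (𝓝 (1 - 1)) := by
          exact (continuous_id.sub continuous_const).tendsto 1
        rw [sub_self] at this
        exact this.mono_left nhdsWithin_le_nhds
      · filter_upwards [self_mem_nhdsWithin] with t ht
        exact sub_neg.2 ht.2
    refine (hl.comp hshift).congr' ?_
    filter_upwards [self_mem_nhdsWithin] with t ht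
    simp [hper t ht]
  have hr' : Tendsto (fun t => (K t : EReal)) (𝓝[Ioo 0 1] 0) (𝓝 ⊥) :=
    hr.mono_left (nhdsWithin_mono _ fun t ht => ht.1)
  have key : ∀ c : ℝ, c ∉ Ioo (0 : ℝ) 1 →
      Tendsto (fun t => (K t : EReal)) (𝓝[Ioo 0 1] c) (𝓝 ⊥) →
      ContinuousAt (expKernelIcc K) c := by
    intro c hc h
    have hz : expKernelIcc K c = 0 := expKernelIcc_of_notMem hc
    rw [ContinuousAt, hz, ← nhdsWithin_univ, ← union_compl_self (Ioo (0 : ℝ) 1),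
      nhdsWithin_union]
    refine Tendsto.sup ((tendsto_exp_of_tendsto_bot h).congr' ?_)
      (tendsto_const_nhds.congr' ?_)
    · filter_upwards [self_mem_nhdsWithin] with t ht
      exact (expKernelIcc_of_mem ht).symm
    · filter_upwards [self_mem_nhdsWithin] with t ht
      exact (expKernelIcc_of_notMem ht).symm
  intro s hs
  by_cases h : s ∈ Ioo (0 : ℝ) 1
  · have hc : ContinuousAt (fun s => Real.exp (K s)) s :=
      Real.continuous_exp.continuousAt.comp
        ((hK.concave_pos.continuousOn isOpen_Ioo).continuousAt (isOpen_Ioo.mem_nhds h))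
    refine (hc.congr ?_).continuousWithinAt
    filter_upwards [isOpen_Ioo.mem_nhds h] with t ht
    exact (expKernelIcc_of_mem ht).symm
  · rcases eq_or_ne s 0 with rfl | h0
    · exact (key 0 h hr').continuousWithinAt
    · have : s = 1 := by
        by_contra h1
        exact h ⟨lt_of_le_of_ne hs.1 (Ne.symm h0), lt_of_le_of_ne hs.2 h1⟩
      subst this
      exact (key 1 h hl').continuousWithinAt

/-- The exponential of a periodic singular kernel function on the torus. -/
noncomputable def expKernel (K : ℝ → ℝ) (x : UnitAddCircle) : ℝ := rexp (torusKernel K x)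

lemma rep_coe {s : ℝ} (hs : s ∈ Ico (0 : ℝ) 1) : rep (s : UnitAddCircle) = s := by
  have hs' : s ∈ Ico (0 : ℝ) (0 + 1) := by simpa using hs
  rw [rep, AddCircle.equivIco_coe_eq hs']

lemma rep_mem (x : UnitAddCircle) : rep x ∈ Ico (0 : ℝ) 1 := by
  have := (AddCircle.equivIco 1 0 x).2
  simpa [rep] using this

lemma coe_rep (x : UnitAddCircle) : (rep x : UnitAddCircle) = x :=
  (AddCircle.equivIco 1 0).symm_apply_apply x

lemma torusKernel_coe {s : ℝ} (hs : s ∈ Ioo (0 : ℝ) 1) : torusKernel K s = K s := by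
  rw [torusKernel, rep_coe ⟨hs.1.le, hs.2⟩, extendKernel,
    if_pos (show s ∈ kernelDomain from Or.inr hs)]

lemma torusKernel_zero (hsing : IsSingular K) : torusKernel K 0 = ⊥ := by
  have : rep (0 : UnitAddCircle) = 0 := by
    have := rep_coe (s := 0) (by simp)
    simpa using this
  rw [torusKernel, this]; exact hsing

lemma expKernel_eq_liftIco (hsing : IsSingular K) :
    expKernel K = AddCircle.liftIco 1 0 (expKernelIcc K) := by
  funext x
  rw [← coe_rep x, AddCircle.liftIco_coe_apply (by simpa using rep_mem x), expKernel]
  rcases eq_or_lt_of_le (rep_mem x).1 with h | h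
  · rw [← h, expKernelIcc_of_notMem (by simp)]
    simp [torusKernel_zero hsing, rexp_bot]
  · have h' : rep x ∈ Ioo (0 : ℝ) 1 := ⟨h, (rep_mem x).2⟩
    rw [torusKernel_coe h', rexp_coe, expKernelIcc_of_mem h']

lemma continuous_expKernel (hK : IsKernel K) (hsing : IsSingular K)
    (hper : IsPeriodicKernel K) : Continuous (expKernel K) := by
  rw [expKernel_eq_liftIco hsing]
  refine AddCircle.liftIco_continuous ?_ ?_
  · simp [expKernelIcc]
  · simpa using continuousOn_expKernelIcc hK hsing hper

lemma expKernel_coe {s : ℝ} (hs : s ∈ Ioo (0 : ℝ) 1) : expKernel K s = Real.exp (K s) := by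
  rw [expKernel, torusKernel_coe hs, rexp_coe]

lemma expKernel_zero (hsing : IsSingular K) : expKernel K 0 = 0 := by
  rw [expKernel, torusKernel_zero hsing, rexp_bot]

lemma torusKernel_ne_top (hsing : IsSingular K) (x : UnitAddCircle) : torusKernel K x ≠ ⊤ := by
  rw [← coe_rep x]
  rcases eq_or_lt_of_le (rep_mem x).1 with h | h
  · rw [← h]
    simp [torusKernel_zero hsing]
  · rw [torusKernel_coe ⟨h, (rep_mem x).2⟩]
    exact EReal.coe_ne_top _

lemma expKernel_pos {x : UnitAddCircle} (hx : x ≠ 0) :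
    0 < expKernel K x := by
  rw [← coe_rep x] at hx ⊢
  rcases eq_or_lt_of_le (rep_mem x).1 with h | h
  · rw [← h] at hx
    simp at hx
  · rw [expKernel_coe ⟨h, (rep_mem x).2⟩]
    exact Real.exp_pos _

end Kernel

/-! ### Sums of translates and existence of a minimax point -/

section SumTranslates

variable {n : ℕ} {ν : Fin n → ℝ} {K : ℝ → ℝ} {J : UnitAddCircle → EReal}

/-- The exponential of the sum of translates function without its field term. -/
noncomputable def kernelProd (ν : Fin n → ℝ) (K : ℝ → ℝ) (y : Fin n → UnitAddCircle)
    (t : UnitAddCircle) : ℝ := ∏ j, expKernel K (t - y j) ^ ν j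

lemma kernelProd_nonneg (y : Fin n → UnitAddCircle) (t : UnitAddCircle) :
    0 ≤ kernelProd ν K y t :=
  Finset.prod_nonneg fun _ _ => Real.rpow_nonneg (rexp_nonneg _) _

lemma rexp_sumTranslates (y : Fin n → UnitAddCircle) (t : UnitAddCircle) :
    rexp (sumTranslates ν K J y t) = rexp (J t) * kernelProd ν K y t := by
  rw [sumTranslates, rexp_add, rexp_sum, kernelProd]
  simp only [rexp_coe_mul, expKernel]

lemma sumTranslates_ne_top (hν : ∀ j, 0 < ν j) (hsing : IsSingular K)
    (hJ : ∀ t, J t ≠ ⊤) (y : Fin n → UnitAddCircle) (t : UnitAddCircle) :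
    sumTranslates ν K J y t ≠ ⊤ := by
  refine EReal.add_ne_top (hJ t) ?_
  have : ∀ s : Finset (Fin n), ∑ j ∈ s, (ν j : EReal) * torusKernel K (t - y j) ≠ ⊤ := by
    intro s
    induction s using Finset.induction_on with
    | empty => simp
    | insert a s ha ih =>
      rw [Finset.sum_insert ha]
      refine EReal.add_ne_top ?_ ih
      have h := torusKernel_ne_top hsing (t - y a)
      induction h' : torusKernel K (t - y a) with
      | bot => simp [EReal.coe_mul_bot_of_pos (hν a)]
      | coe r => rw [← EReal.coe_mul]; exact EReal.coe_ne_top _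
      | top => exact absurd h' h
  exact this _

lemma sumTranslates_le_iff (hν : ∀ j, 0 < ν j) (hsing : IsSingular K)
    (hJ : ∀ t, J t ≠ ⊤) (y : Fin n → UnitAddCircle) (t : UnitAddCircle) (c : ℝ) :
    sumTranslates ν K J y t ≤ c ↔ rexp (J t) * kernelProd ν K y t ≤ Real.exp c := by
  rw [← rexp_sumTranslates, rexp_le_exp_iff (sumTranslates_ne_top hν hsing hJ y t)]

lemma continuous_kernelProd (hν : ∀ j, 0 < ν j) (hK : IsKernel K) (hsing : IsSingular K)
    (hper : IsPeriodicKernel K) {X : Type*} [TopologicalSpace X] {y : X → Fin n → UnitAddCircle}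
    {t : X → UnitAddCircle} (hy : Continuous y) (ht : Continuous t) :
    Continuous fun p => kernelProd ν K (y p) (t p) := by
  refine continuous_finsetProd _ fun j _ => ?_
  refine Continuous.rpow_const ?_ fun _ => Or.inr (hν j).le
  have := continuous_expKernel hK hsing hper
  fun_prop

lemma kernelProd_eq_zero (hν : ∀ j, 0 < ν j) (hsing : IsSingular K)
    (y : Fin n → UnitAddCircle) (j : Fin n) : kernelProd ν K y (y j) = 0 := by
  refine Finset.prod_eq_zero (Finset.mem_univ j) ?_
  rw [sub_self, expKernel_zero hsing, Real.zero_rpow (hν j).ne']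

lemma kernelProd_pos {y : Fin n → UnitAddCircle} {t : UnitAddCircle} (h : ∀ j, t ≠ y j) :
    0 < kernelProd ν K y t :=
  Finset.prod_pos fun j _ =>
    Real.rpow_pos_of_pos (expKernel_pos (sub_ne_zero.2 (h j))) _

/-- With t fixed, J enters only through the constant `J t`, so no regularity of J is needed. -/
lemma continuous_sumTranslates (hν : ∀ j, 0 < ν j) (hK : IsKernel K) (hsing : IsSingular K)
    (hper : IsPeriodicKernel K) (hJ : ∀ t, J t ≠ ⊤) (t : UnitAddCircle) :
    Continuous fun y : Fin n → UnitAddCircle => sumTranslates ν K J y t := by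
  have : (fun y : Fin n → UnitAddCircle => sumTranslates ν K J y t) =
      fun y => ENNReal.log (ENNReal.ofReal (rexp (J t) * kernelProd ν K y t)) := by
    funext y
    rw [← rexp_sumTranslates, log_ofReal_rexp (sumTranslates_ne_top hν hsing hJ y t)]
  rw [this]
  refine ENNReal.continuous_log.comp (ENNReal.continuous_ofReal.comp ?_)
  exact continuous_const.mul
    (continuous_kernelProd hν hK hsing hper continuous_id continuous_const)

lemma torusMax_ne_top (hν : ∀ j, 0 < ν j) (hK : IsKernel K) (hsing : IsSingular K)
    (hper : IsPeriodicKernel K) (hJ : IsField n J) (y : Fin n → UnitAddCircle) :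
    torusMax ν K J y ≠ ⊤ := by
  obtain ⟨C, hC⟩ := hJ.bddAbove
  have hJ' : ∀ t, J t ≠ ⊤ := fun t => ((hC t).trans_lt (EReal.coe_lt_top C)).ne
  have hcont : Continuous fun t => kernelProd ν K y t :=
    continuous_kernelProd hν hK hsing hper continuous_const continuous_id
  obtain ⟨B, hB⟩ := (isCompact_range hcont).bddAbove
  have hB' : ∀ t, kernelProd ν K y t ≤ B := fun t => hB ⟨t, rfl⟩
  have hpos : 0 < |B| + 1 := by positivity
  refine ne_top_of_le_ne_top (EReal.coe_ne_top (C + Real.log (|B| + 1))) (iSup_le fun t => ?_)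
  rw [sumTranslates_le_iff hν hsing hJ', Real.exp_add, Real.exp_log hpos]
  exact mul_le_mul ((rexp_le_exp_iff (hJ' t) C).2 (hC t))
    ((hB' t).trans ((le_abs_self B).trans (by linarith))) (kernelProd_nonneg _ _)
    (Real.exp_nonneg _)

/-- The n nodes cannot cover the more than n points where J is finite. -/
lemma torusMax_ne_bot (hJ : IsField n J) (y : Fin n → UnitAddCircle) :
    torusMax ν K J y ≠ ⊥ := by
  obtain ⟨t, ht, hty⟩ : ∃ t, J t ≠ ⊥ ∧ t ∉ range y := by
    by_contra! h
    have h1 : {t | J t ≠ ⊥}.encard ≤ n := by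
      refine (encard_le_encard (t := range y) h).trans ?_
      rw [← image_univ]
      exact (encard_image_le _ _).trans (by simp)
    exact absurd hJ.finite_at (not_lt.2 h1)
  intro hbot
  have h2 : sumTranslates ν K J y t = ⊥ :=
    le_bot_iff.1 ((le_iSup (fun t => sumTranslates ν K J y t) t).trans hbot.le)
  have h3 := rexp_sumTranslates (ν := ν) (K := K) (J := J) y t
  rw [h2, rexp_bot] at h3
  have h4 := kernelProd_pos (ν := ν) (K := K) (y := y) (t := t) fun j hj => hty ⟨j, hj.symm⟩
  obtain ⟨C, hC⟩ := hJ.bddAbove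
  have h5 : 0 < rexp (J t) := ENNReal.toReal_pos (by simpa using ht)
    (by simpa using ((hC t).trans_lt (EReal.coe_lt_top C)).ne)
  exact absurd h3 (mul_pos h5 h4).ne

lemma isCompact_closedSimplex [NeZero n] : IsCompact (closedSimplex n) := by
  have hc : IsCompact ({x : Fin n → ℝ | Monotone x ∧ (∀ i j, x j ≤ x i + 1)} ∩
      Set.pi univ fun _ => Icc (0 : ℝ) 2) := by
    refine (isCompact_univ_pi fun _ => isCompact_Icc).inter_left ?_
    have e : {x : Fin n → ℝ | Monotone x ∧ (∀ i j, x j ≤ x i + 1)} =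
        {x : Fin n → ℝ | Monotone x} ∩ ⋂ i, ⋂ j, {x | x j ≤ x i + 1} := by
      ext; simp
    rw [e]
    refine isClosed_monotone.inter (isClosed_iInter fun i => isClosed_iInter fun j => ?_)
    exact isClosed_le (continuous_apply j) ((continuous_apply i).add continuous_const)
  have hf : Continuous fun (x : Fin n → ℝ) j => (x j : UnitAddCircle) :=
    continuous_pi fun j => (AddCircle.continuous_mk' 1).comp (continuous_apply j)
  convert hc.image hf
  ext y
  constructor
  · rintro ⟨x, hxy, hx, hx1⟩
    -- Subtracting the integer part of `x 0` puts the first lift in [0,1), hence all lifts in [0,2].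
    refine ⟨fun j => x j - ⌊x 0⌋, ⟨⟨fun i j hij => by simpa using hx hij, fun i j => ?_⟩,
      fun j _ => ?_⟩, ?_⟩
    · have := hx1 i j
      linarith
    · have h1 := hx1 0 j
      have h2 := hx (Fin.zero_le j)
      have h3 := Int.floor_le (x 0)
      have h4 := Int.lt_floor_add_one (x 0)
      exact ⟨by linarith, by linarith⟩
    · funext j
      rw [← hxy]
      simp
  · rintro ⟨x, ⟨hx, -⟩, rfl⟩
    exact ⟨x, fun _ => rfl, hx.1, hx.2⟩

lemma closedSimplex_nonempty : (closedSimplex n).Nonempty :=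
  ⟨fun _ => ((0 : ℝ) : UnitAddCircle), fun _ => 0, fun _ => rfl, monotone_const, by simp⟩

lemma exists_isMinimaxPoint [NeZero n] (hν : ∀ j, 0 < ν j) (hK : IsKernel K)
    (hsing : IsSingular K) (hper : IsPeriodicKernel K) (hJ : ∀ t, J t ≠ ⊤) :
    ∃ w : Fin n → UnitAddCircle, IsMinimaxPoint ν K J w := by
  have hlsc : LowerSemicontinuous (torusMax ν K J) := by
    have := lowerSemicontinuous_iSup fun t =>
      (continuous_sumTranslates hν hK hsing hper hJ t).lowerSemicontinuous
    exact this
  obtain ⟨w, hw, hmin⟩ := (hlsc.lowerSemicontinuousOn _).exists_isMinOn closedSimplex_nonempty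
    isCompact_closedSimplex
  exact ⟨w, hw, le_antisymm (le_iInf₂ fun y hy => hmin hy) (iInf₂_le w hw)⟩

end SumTranslates

/-! ### Perturbing the two extreme clusters of nodes -/

/-- Both inner points lie strictly above the chord over `[x₁, x₄]`. By `h` the two pairs have the
same weighted mean, so the affine chord has the same weighted sum on both. -/
lemma weighted_add_lt_of_spread {f : ℝ → ℝ} {s : Set ℝ} (hf : StrictConcaveOn ℝ s f)
    {p q x₁ x₂ x₃ x₄ : ℝ} (hp : 0 < p) (hx₁ : x₁ ∈ s) (hx₄ : x₄ ∈ s) (h₁₂ : x₁ < x₂)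
    (h₂₃ : x₂ ≤ x₃) (h₃₄ : x₃ < x₄) (hq : 0 < q) (h : q * (x₂ - x₁) = p * (x₄ - x₃)) :
    q * f x₁ + p * f x₄ < q * f x₂ + p * f x₃ := by
  have hne : x₁ ≠ x₄ := by linarith
  have hd : 0 < x₄ - x₁ := by linarith
  have key : ∀ z, x₁ < z → z < x₄ →
      (x₄ - z) * f x₁ + (z - x₁) * f x₄ < (x₄ - x₁) * f z := by
    intro z hz1 hz4
    have := hf.2 hx₁ hx₄ hne (div_pos (sub_pos.2 hz4) hd) (div_pos (sub_pos.2 hz1) hd)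
      (by field_simp; ring)
    have e : ((x₄ - z) / (x₄ - x₁)) • x₁ + ((z - x₁) / (x₄ - x₁)) • x₄ = z := by
      simp only [smul_eq_mul]; field_simp; ring
    rw [e] at this
    simp only [smul_eq_mul] at this
    have h2 := mul_lt_mul_of_pos_left this hd
    calc _ = (x₄ - x₁) * ((x₄ - z) / (x₄ - x₁) * f x₁ + (z - x₁) / (x₄ - x₁) * f x₄) := by
          field_simp
      _ < _ := h2
  have k2 := mul_lt_mul_of_pos_left (key x₂ h₁₂ (by linarith)) hq
  have k3 := mul_lt_mul_of_pos_left (key x₃ (by linarith) h₃₄) hp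
  have : (x₄ - x₁) * (q * f x₁ + p * f x₄) < (x₄ - x₁) * (q * f x₂ + p * f x₃) := by
    have e : (x₄ - x₁) * (q * f x₁ + p * f x₄) =
        q * ((x₄ - x₂) * f x₁ + (x₂ - x₁) * f x₄) + p * ((x₄ - x₃) * f x₁ + (x₃ - x₁) * f x₄) := by
      linear_combination (f x₁ - f x₄) * h
    rw [e]
    linarith
  exact lt_of_mul_lt_mul_left this hd.le

variable {n : ℕ} {ν : Fin n → ℝ} {K : ℝ → ℝ} {J : UnitAddCircle → EReal}

/-- The total weight of the nodes at the point `c`. -/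
noncomputable def nodeWeight (ν x : Fin n → ℝ) (c : ℝ) : ℝ := ∑ i, if x i = c then ν i else 0

lemma nodeWeight_pos (hν : ∀ j, 0 < ν j) (x : Fin n → ℝ) (i : Fin n) :
    0 < nodeWeight ν x (x i) := by
  refine Finset.sum_pos' (fun j _ => ?_) ⟨i, Finset.mem_univ i, ?_⟩
  · split_ifs
    exacts [(hν j).le, le_rfl]
  · simpa using hν i

/-- The nodes `x`, clamped to `[b, a]`, on the torus. -/
noncomputable def clampNodes (x : Fin n → ℝ) (b a : ℝ) (i : Fin n) : UnitAddCircle :=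
  ((max b (min a (x i)) : ℝ) : UnitAddCircle)

lemma kernelProd_eq_exp {y : Fin n → UnitAddCircle} {t : UnitAddCircle} (h : ∀ j, t ≠ y j) :
    kernelProd ν K y t = Real.exp (∑ j, ν j * Real.log (expKernel K (t - y j))) := by
  rw [Real.exp_sum, kernelProd]
  refine Finset.prod_congr rfl fun j _ => ?_
  rw [Real.rpow_def_of_pos (expKernel_pos (sub_ne_zero.2 (h j))), mul_comm]

lemma log_expKernel_coe {s : ℝ} (hs : s ∈ Ioo (0 : ℝ) 1) : Real.log (expKernel K s) = K s := by
  rw [expKernel_coe hs, Real.log_exp]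

/-- Moving the two extreme clusters of nodes towards each other, with fixed centre of mass,
decreases the kernel product between them. -/
lemma kernelProd_clampNodes_lt (hν : ∀ j, 0 < ν j) (hsing : IsSingular K)
    (hconc : IsStrictlyConcave K) {x : Fin n → ℝ} {i₀ i₁ : Fin n}
    (hle : x i₁ ≤ x i₀ + 1) {b a : ℝ} (hb : x i₀ < b) (ha : a < x i₁)
    (hmass : nodeWeight ν x (x i₀) * (b - x i₀) = nodeWeight ν x (x i₁) * (x i₁ - a))
    (hmid : ∀ i, x i = x i₀ ∨ x i = x i₁ ∨ b ≤ x i ∧ x i ≤ a) {t : ℝ} (ht : t ∈ Icc b a)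
    (hpos : 0 < kernelProd ν K (clampNodes x b a) t) :
    kernelProd ν K (clampNodes x b a) t < kernelProd ν K (fun i => (x i : UnitAddCircle)) t := by
  have hba : b ≤ a := ht.1.trans ht.2
  have hB : ∀ i, x i = x i₀ → max b (min a (x i)) = b := fun i hi => by
    rw [hi, min_eq_right (by linarith), max_eq_left hb.le]
  have hA : ∀ i, x i = x i₁ → max b (min a (x i)) = a := fun i hi => by
    rw [hi, min_eq_left ha.le, max_eq_right hba]
  have hM : ∀ i, b ≤ x i ∧ x i ≤ a → max b (min a (x i)) = x i := fun i hi => by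
    rw [min_eq_right hi.2, max_eq_right hi.1]
  have hne : ∀ j, (t : UnitAddCircle) ≠ clampNodes x b a j := by
    intro j hj
    rw [hj, kernelProd_eq_zero hν hsing] at hpos
    exact lt_irrefl _ hpos
  have htb : b < t := by
    refine lt_of_le_of_ne ht.1 fun h => hne i₀ ?_
    rw [clampNodes, hB i₀ rfl, h]
  have hta : t < a := by
    refine lt_of_le_of_ne ht.2 fun h => hne i₁ ?_
    rw [clampNodes, hA i₁ rfl, h]
  -- Arguments for nodes to the right of t are shifted by a period, so that all cluster arguments
  -- lie in (0,1), where K is a single concave function.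
  have hshift : ∀ c : ℝ,
      (t : UnitAddCircle) - (c : UnitAddCircle) = ((t - c + 1 : ℝ) : UnitAddCircle) := by
    intro c
    rw [AddCircle.coe_add, AddCircle.coe_period, add_zero, AddCircle.coe_sub]
  have hs₁ : t - b ∈ Ioo (0 : ℝ) 1 := ⟨by linarith, by linarith⟩
  have hs₀ : t - x i₀ ∈ Ioo (0 : ℝ) 1 := ⟨by linarith, by linarith⟩
  have hu₁ : t - a + 1 ∈ Ioo (0 : ℝ) 1 := ⟨by linarith, by linarith⟩
  have hu₀ : t - x i₁ + 1 ∈ Ioo (0 : ℝ) 1 := ⟨by linarith, by linarith⟩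
  have hne' : ∀ j, (t : UnitAddCircle) ≠ (x j : UnitAddCircle) := by
    intro j hj
    rcases hmid j with h | h | h
    · rw [h, ← sub_eq_zero, ← AddCircle.coe_sub] at hj
      have := rep_coe ⟨hs₀.1.le, hs₀.2⟩
      rw [hj, ← AddCircle.coe_zero, rep_coe (by simp)] at this
      exact hs₀.1.ne this
    · rw [h, ← sub_eq_zero, hshift] at hj
      have := rep_coe ⟨hu₀.1.le, hu₀.2⟩
      rw [hj, ← AddCircle.coe_zero, rep_coe (by simp)] at this
      exact hu₀.1.ne this
    · exact hne j (by rw [clampNodes, hM j h, hj])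
  rw [kernelProd_eq_exp hne, kernelProd_eq_exp hne', Real.exp_lt_exp, ← sub_pos,
    ← Finset.sum_sub_distrib]
  have hterm : ∀ j, ν j * Real.log (expKernel K (t - (x j : UnitAddCircle))) -
      ν j * Real.log (expKernel K (t - clampNodes x b a j)) =
      (if x j = x i₀ then ν j else 0) * (K (t - x i₀) - K (t - b)) +
      (if x j = x i₁ then ν j else 0) * (K (t - x i₁ + 1) - K (t - a + 1)) := by
    intro j
    rcases hmid j with h | h | h
    · have h1 : x j ≠ x i₁ := by linarith
      rw [if_pos h, if_neg h1, clampNodes, hB j h, h, ← AddCircle.coe_sub, ← AddCircle.coe_sub,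
        log_expKernel_coe hs₀, log_expKernel_coe hs₁]
      ring
    · have h1 : x j ≠ x i₀ := by linarith
      rw [if_pos h, if_neg h1, clampNodes, hA j h, h, hshift, hshift,
        log_expKernel_coe hu₀, log_expKernel_coe hu₁]
      ring
    · have h1 : x j ≠ x i₀ := by linarith
      have h2 : x j ≠ x i₁ := by linarith
      rw [if_neg h1, if_neg h2, clampNodes, hM j h]
      ring
  simp only [hterm]
  rw [Finset.sum_add_distrib, ← Finset.sum_mul, ← Finset.sum_mul]
  -- Moving the clusters inwards spreads these arguments apart; `x₂ ≤ x₃` is the condition that the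
  -- nodes fit in one period.
  have := weighted_add_lt_of_spread hconc.2
    (x₁ := t - b) (x₂ := t - x i₀) (x₃ := t - x i₁ + 1) (x₄ := t - a + 1)
    (nodeWeight_pos hν x i₁) hs₁ hu₁ (by linarith) (by linarith) (by linarith)
    (nodeWeight_pos hν x i₀) (by rw [sub_sub_sub_cancel_left, hmass]; ring)
  simp only [nodeWeight] at this
  linarith

lemma clampNodes_mem_closedSimplex {x : Fin n → ℝ} (hx : Monotone x) {b a : ℝ} (hba : b ≤ a)
    (hab : a ≤ b + 1) : clampNodes x b a ∈ closedSimplex n := by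
  refine ⟨fun i => max b (min a (x i)), fun _ => rfl, fun i j hij => ?_, fun i j => ?_⟩
  · exact max_le_max le_rfl (min_le_min le_rfl (hx hij))
  · have h1 : max b (min a (x j)) ≤ a := max_le hba (min_le_left _ _)
    have h2 : b ≤ max b (min a (x i)) := le_max_left _ _
    linarith

/-- The factor is the maximum of f / g, attained by compactness. -/
lemma exists_lt_one_forall_le_mul {s : Set ℝ} (hs : IsCompact s) {f g : ℝ → ℝ}
    (hf : ContinuousOn f s) (hg : ContinuousOn g s) (hpos : ∀ t ∈ s, 0 < f t)
    (hlt : ∀ t ∈ s, f t < g t) : ∃ q < 1, 0 < q ∧ ∀ t ∈ s, f t ≤ q * g t := by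
  rcases s.eq_empty_or_nonempty with rfl | hne
  · exact ⟨1 / 2, by norm_num, by norm_num, by simp⟩
  have hg0 : ∀ t ∈ s, 0 < g t := fun t ht => (hpos t ht).trans (hlt t ht)
  obtain ⟨t₀, ht₀, hmax⟩ := hs.exists_isMaxOn hne (hf.div hg fun t ht => (hg0 t ht).ne')
  refine ⟨f t₀ / g t₀, (div_lt_one (hg0 _ ht₀)).2 (hlt _ ht₀), div_pos (hpos _ ht₀) (hg0 _ ht₀),
    fun t ht => ?_⟩
  exact (div_le_iff₀ (hg0 t ht)).1 (hmax ht)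

/-- If the sum of translates function stays below its bound on the arc outside the nodes, then
moving the extreme nodes inwards lowers the bound. -/
lemma exists_closedSimplex_bound_lt (hν : ∀ j, 0 < ν j) (hK : IsKernel K) (hsing : IsSingular K)
    (hconc : IsStrictlyConcave K) (hper : IsPeriodicKernel K) {C : ℝ} (hJ : ∀ t, J t ≤ C)
    {x : Fin n → ℝ} (hx : Monotone x) {i₀ i₁ : Fin n} (h₀ : ∀ i, x i₀ ≤ x i)
    (h₁ : ∀ i, x i ≤ x i₁) (h₀₁ : x i₀ < x i₁) (hle : x i₁ ≤ x i₀ + 1) {m m' : ℝ} (hm : m' < m)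
    (hmax : ∀ t, sumTranslates ν K J (fun i => (x i : UnitAddCircle)) t ≤ m)
    (harc : ∀ t ∈ Icc (x i₁) (x i₀ + 1),
      sumTranslates ν K J (fun i => (x i : UnitAddCircle)) (t : UnitAddCircle) ≤ m') :
    ∃ y ∈ closedSimplex n, ∃ c < m, ∀ t, sumTranslates ν K J y t ≤ (c : EReal) := by
  have hJtop : ∀ t, J t ≠ ⊤ := fun t => ((hJ t).trans_lt (EReal.coe_lt_top C)).ne
  have hjE : ∀ t, rexp (J t) ≤ Real.exp C := fun t => (rexp_le_exp_iff (hJtop t) C).2 (hJ t)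
  have hE := Real.exp_pos C
  have hM := Real.exp_lt_exp.2 hm
  have hM' := Real.exp_pos m'
  simp only [sumTranslates_le_iff hν hsing hJtop] at hmax harc ⊢
  set b := x i₀ with hb
  set a := x i₁ with ha
  have hQ : 0 < nodeWeight ν x b := nodeWeight_pos hν x i₀
  have hP : 0 < nodeWeight ν x a := nodeWeight_pos hν x i₁
  set Q := nodeWeight ν x b with hQdef
  set P := nodeWeight ν x a with hPdef
  -- Displacements h/Q and h/P keep the weighted centre of mass of the two clusters fixed.
  set Y : ℝ → Fin n → UnitAddCircle := fun h => clampNodes x (b + h / Q) (a - h / P) with hY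
  have hY0 : Y 0 = fun i => (x i : UnitAddCircle) := by
    funext i
    simp [hY, clampNodes, min_eq_right (h₁ i), max_eq_right (h₀ i)]
  have hYc : Continuous Y := by
    refine continuous_pi fun i => ?_
    exact (AddCircle.continuous_mk' 1).comp (by fun_prop)
  have hΨ : Continuous fun p : ℝ × ℝ => kernelProd ν K (Y p.1) (p.2 : UnitAddCircle) :=
    continuous_kernelProd hν hK hsing hper (hYc.comp continuous_fst)
      ((AddCircle.continuous_mk' 1).comp continuous_snd)
  have hΨt : ∀ h, Continuous fun t : ℝ => kernelProd ν K (Y h) (t : UnitAddCircle) := fun h =>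
    continuous_kernelProd hν hK hsing hper continuous_const (AddCircle.continuous_mk' 1)
  obtain ⟨η, hη, hη'⟩ : ∃ η > 0, Real.exp m' + Real.exp C * η < Real.exp m := by
    -- This η uses up half of the gap between exp m' and exp m.
    refine ⟨(Real.exp m - Real.exp m') / (2 * Real.exp C), div_pos (by linarith) (by linarith), ?_⟩
    have : Real.exp C * ((Real.exp m - Real.exp m') / (2 * Real.exp C)) =
        (Real.exp m - Real.exp m') / 2 := by field_simp
    linarith
  -- Compactness of a period makes the growth bound uniform in t.
  have e₁ : ∀ᶠ h in 𝓝 (0 : ℝ), ∀ t ∈ Icc b (b + 1),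
      kernelProd ν K (Y h) (t : UnitAddCircle) < kernelProd ν K (Y 0) (t : UnitAddCircle) + η := by
    refine isCompact_Icc.eventually_forall_of_forall_eventually fun t _ => ?_
    have hc : Continuous fun p : ℝ × ℝ => kernelProd ν K (Y 0) (p.2 : UnitAddCircle) + η :=
      ((hΨt 0).comp continuous_snd).add continuous_const
    exact (isOpen_lt hΨ hc).mem_nhds (lt_add_of_pos_right _ hη)
  have near : ∀ i, ∃ ε > 0, ∀ h, |h| < ε → ∀ t, |t - x i| < ε →
      kernelProd ν K (Y h) (t : UnitAddCircle) < η := by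
    intro i
    have h0 : kernelProd ν K (Y 0) (x i : UnitAddCircle) < η := by
      rw [hY0, kernelProd_eq_zero hν hsing (fun i => (x i : UnitAddCircle)) i]; exact hη
    have hmem : {p : ℝ × ℝ | kernelProd ν K (Y p.1) (p.2 : UnitAddCircle) < η} ∈
        𝓝 ((0 : ℝ), x i) := (isOpen_lt hΨ continuous_const).mem_nhds h0
    obtain ⟨ε, hε, H⟩ := Metric.eventually_nhds_iff.1 hmem
    refine ⟨ε, hε, fun h hh t ht => H (y := (h, t)) ?_⟩
    rw [Prod.dist_eq]
    exact max_lt (by simpa using hh) (by simpa [Real.dist_eq] using ht)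
  obtain ⟨ε₀, hε₀, near₀⟩ := near i₀
  obtain ⟨ε₁, hε₁, near₁⟩ := near i₁
  have lt_of : ∀ {f g : ℝ → ℝ}, Continuous f → Continuous g → f 0 < g 0 →
      ∀ᶠ h in 𝓝 (0 : ℝ), f h < g h := fun hf hg h =>
    hf.continuousAt.eventually_lt hg.continuousAt h
  have cQ : Continuous fun h : ℝ => b + h / Q := by fun_prop
  have cP : Continuous fun h : ℝ => a - h / P := by fun_prop
  have e₂ : ∀ᶠ h in 𝓝 (0 : ℝ), b + h / Q < a - h / P := lt_of cQ cP (by simpa using h₀₁)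
  have e₃ : ∀ᶠ h in 𝓝 (0 : ℝ), ∀ i, x i = b ∨ x i = a ∨ b + h / Q ≤ x i ∧ x i ≤ a - h / P := by
    refine eventually_all.2 fun i => ?_
    by_cases hib : x i = b
    · exact Eventually.of_forall fun _ => Or.inl hib
    by_cases hia : x i = a
    · exact Eventually.of_forall fun _ => Or.inr (Or.inl hia)
    filter_upwards [lt_of cQ (continuous_const (y := x i))
      (by simpa using lt_of_le_of_ne (h₀ i) (Ne.symm hib)),
      lt_of (continuous_const (y := x i)) cP
      (by simpa using lt_of_le_of_ne (h₁ i) hia)] with h h2 h3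
    exact Or.inr (Or.inr ⟨h2.le, h3.le⟩)
  have e₄ : ∀ᶠ h in 𝓝 (0 : ℝ), |h| < ε₀ :=
    lt_of continuous_abs continuous_const (by simpa using hε₀)
  have e₅ : ∀ᶠ h in 𝓝 (0 : ℝ), |h| < ε₁ :=
    lt_of continuous_abs continuous_const (by simpa using hε₁)
  have e₆ : ∀ᶠ h in 𝓝 (0 : ℝ), h / Q < ε₀ :=
    lt_of (by fun_prop) continuous_const (by simpa using hε₀)
  have e₇ : ∀ᶠ h in 𝓝 (0 : ℝ), h / P < ε₁ :=
    lt_of (by fun_prop) continuous_const (by simpa using hε₁)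
  have ev := (((((e₁.and e₂).and e₃).and e₄).and e₅).and e₆).and e₇
  obtain ⟨h, ⟨⟨⟨⟨⟨⟨f₁, f₂⟩, f₃⟩, f₄⟩, f₅⟩, f₆⟩, f₇⟩, hpos : 0 < h⟩ :=
    ((ev.filter_mono nhdsWithin_le_nhds).and (self_mem_nhdsWithin (s := Ioi (0 : ℝ)))).exists
  have hhQ : 0 < h / Q := div_pos hpos hQ
  have hhP : 0 < h / P := div_pos hpos hP
  -- The cutoff at η removes the nodes, where the products vanish and strict decrease can fail. What
  -- remains is compact, so the decrease has a uniform factor q < 1.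
  set s : Set ℝ := Icc (b + h / Q) (a - h / P) ∩
    {t | η ≤ kernelProd ν K (Y h) (t : UnitAddCircle)} with hs
  have hscompact : IsCompact s :=
    isCompact_Icc.inter_right (isClosed_le continuous_const (hΨt h))
  obtain ⟨q, hq1, hq0, hq⟩ := exists_lt_one_forall_le_mul hscompact
    (hΨt h).continuousOn (hΨt 0).continuousOn (fun t ht => hη.trans_le ht.2) (fun t ht => by
      simp only [hY0]
      refine kernelProd_clampNodes_lt hν hsing hconc hle (by linarith) (by linarith) ?_ f₃ ht.1
        (hη.trans_le ht.2)
      rw [← hb, ← ha, ← hQdef, ← hPdef]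
      field_simp
      ring)
  have hcpos : 0 < max (Real.exp m' + Real.exp C * η) (q * Real.exp m) :=
    lt_max_of_lt_left (by positivity)
  refine ⟨Y h, clampNodes_mem_closedSimplex hx f₂.le (by linarith),
    Real.log (max (Real.exp m' + Real.exp C * η) (q * Real.exp m)), ?_, fun t => ?_⟩
  · rw [Real.log_lt_iff_lt_exp hcpos]
    refine max_lt hη' ?_
    have := Real.exp_pos m
    nlinarith
  rw [Real.exp_log hcpos]
  obtain ⟨t, ht, rfl⟩ : ∃ s ∈ Icc b (b + 1), (s : UnitAddCircle) = t := by
    refine ⟨b + rep (t - b), ⟨?_, ?_⟩, ?_⟩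
    · linarith [(rep_mem (t - b)).1]
    · linarith [(rep_mem (t - b)).2]
    · rw [AddCircle.coe_add, coe_rep, add_sub_cancel]
  have hj0 := rexp_nonneg (J t)
  have small : kernelProd ν K (Y h) (t : UnitAddCircle) < η →
      rexp (J t) * kernelProd ν K (Y h) (t : UnitAddCircle) ≤
      max (Real.exp m' + Real.exp C * η) (q * Real.exp m) := fun hlt =>
    le_max_of_le_left <| by
      have := mul_le_mul (hjE t) hlt.le (kernelProd_nonneg _ _) hE.le
      linarith
  -- On the chosen arc the slack between m' and m absorbs the growth. In the two gaps swept by the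
  -- clusters, and wherever the product is below η, boundedness of J suffices. The rest is the
  -- compact set `s`.
  rcases le_or_gt a t with hat | hat
  · refine le_max_of_le_left ?_
    have k1 := harc t ⟨hat, ht.2⟩
    have k2 := f₁ t ht
    rw [hY0] at k2
    calc _ ≤ rexp (J t) * (kernelProd ν K (fun i => (x i : UnitAddCircle)) t + η) := by gcongr
      _ = rexp (J t) * kernelProd ν K (fun i => (x i : UnitAddCircle)) t + rexp (J t) * η := by ring
      _ ≤ _ := by gcongr; exact hjE t
  rcases lt_or_ge t (b + h / Q) with htb | htb
  · refine small (near₀ h f₄ t ?_)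
    rw [abs_of_nonneg (by linarith [ht.1])]
    linarith
  rcases lt_or_ge (a - h / P) t with hta | hta
  · refine small (near₁ h f₅ t ?_)
    rw [abs_of_neg (by linarith)]
    linarith
  by_cases hlt : kernelProd ν K (Y h) (t : UnitAddCircle) < η
  · exact small hlt
  refine le_max_of_le_right ?_
  have k1 := hq t ⟨⟨htb, hta⟩, not_lt.1 hlt⟩
  rw [hY0] at k1
  calc _ ≤ rexp (J t) * (q * kernelProd ν K (fun i => (x i : UnitAddCircle)) t) := by gcongr
    _ = q * (rexp (J t) * kernelProd ν K (fun i => (x i : UnitAddCircle)) t) := by ring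
    _ ≤ _ := by gcongr; exact hmax t

/-! ### Cyclic relabelling, arcs and equioscillation -/

/-- Indices that wrap around have their lifts raised by one period, which preserves order and total
spread. -/
lemma closedSimplex_rotate {y : Fin n → UnitAddCircle} (hy : y ∈ closedSimplex n) (k : Fin n) :
    (fun i => y (i + k)) ∈ closedSimplex n := by
  obtain ⟨x, hxy, hx, hx1⟩ := hy
  refine ⟨fun i => if (i : ℕ) + k < n then x (i + k) else x (i + k) + 1, fun i => ?_,
    fun i j hij => ?_, fun i j => ?_⟩
  · dsimp only
    split_ifs
    · exact hxy _
    · rw [AddCircle.coe_add, AddCircle.coe_period, add_zero, hxy]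
  all_goals
    have hi := i.2
    have hj := j.2
    have hk := k.2
    have h1 := hx1 (i + k) (j + k)
    have vi : ((i + k : Fin n) : ℕ) = if n ≤ (i : ℕ) + k then (i : ℕ) + k - n else i + k :=
      Fin.val_add_eq_ite i k
    have vj : ((j + k : Fin n) : ℕ) = if n ≤ (j : ℕ) + k then (j : ℕ) + k - n else j + k :=
      Fin.val_add_eq_ite j k
    dsimp only
  · have hij' : (i : ℕ) ≤ j := hij
    split_ifs with h2 h3 h3
    · exact hx (Fin.le_def.2 (by rw [vi, vj, if_neg (by omega), if_neg (by omega)]; omega))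
    · exact hx1 (j + k) (i + k)
    · omega
    · have := hx (show i + k ≤ j + k from Fin.le_def.2
        (by rw [vi, vj, if_pos (by omega), if_pos (by omega)]; omega))
      linarith
  · split_ifs with h2 h3 h3
    · exact h1
    · linarith
    · have := hx (show j + k ≤ i + k from Fin.le_def.2
        (by rw [vi, vj, if_pos (by omega), if_neg (by omega)]; omega))
      linarith
    · linarith

lemma sumTranslates_comp_equiv (σ : Fin n ≃ Fin n) (y : Fin n → UnitAddCircle)
    (t : UnitAddCircle) :
    sumTranslates (ν ∘ σ) K J (y ∘ σ) t = sumTranslates ν K J y t := by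
  simp only [sumTranslates, Function.comp_apply]
  rw [Equiv.sum_comp σ fun j => (ν j : EReal) * torusKernel K (t - y j)]

lemma left_mem_ccwArc (a b : UnitAddCircle) : a ∈ ccwArc a b := by
  have h := rep_coe (s := 0) (by simp)
  rw [AddCircle.coe_zero] at h
  rw [ccwArc, mem_ofPred_eq, sub_self, h]
  exact (rep_mem _).1

lemma ccwArc_self (a : UnitAddCircle) : ccwArc a a = {a} := by
  ext t
  have h := rep_coe (s := 0) (by simp)
  rw [AddCircle.coe_zero] at h
  rw [ccwArc, mem_ofPred_eq, sub_self, h, mem_singleton_iff]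
  constructor
  · intro ht
    have h0 : rep (t - a) = 0 := le_antisymm ht (rep_mem _).1
    rw [← sub_eq_zero, ← coe_rep (t - a), h0, AddCircle.coe_zero]
  · rintro rfl
    rw [sub_self, h]

lemma sumTranslates_node (hν : ∀ j, 0 < ν j) (hsing : IsSingular K) (hJ : ∀ t, J t ≠ ⊤)
    (y : Fin n → UnitAddCircle) (j : Fin n) : sumTranslates ν K J y (y j) = ⊥ := by
  rw [← log_ofReal_rexp (sumTranslates_ne_top hν hsing hJ y (y j)), rexp_sumTranslates,
    kernelProd_eq_zero hν hsing]
  simp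

section Arcs

variable [NeZero n]

lemma mem_arc (y : Fin n → UnitAddCircle) (j : Fin n) : y j ∈ arc y j := by
  rw [arc]
  split_ifs
  exacts [mem_univ _, left_mem_ccwArc _ _]

lemma arcMax_le_torusMax (y : Fin n → UnitAddCircle) (j : Fin n) :
    arcMax ν K J y j ≤ torusMax ν K J y :=
  iSup₂_le fun t _ => le_iSup (fun t => sumTranslates ν K J y t) t

lemma exists_bound_lt_of_arc_le (hν : ∀ j, 0 < ν j) (hK : IsKernel K) (hsing : IsSingular K)
    (hconc : IsStrictlyConcave K) (hper : IsPeriodicKernel K) {C : ℝ} (hJ : ∀ t, J t ≤ C)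
    {w : Fin n → UnitAddCircle} (hw : w ∈ closedSimplex n) (j : Fin n)
    (hcase : ¬ ((∀ i, w i = w j) ∧ (j : ℕ) + 1 = n)) {m m' : ℝ} (hm : m' < m)
    (hmax : ∀ t, sumTranslates ν K J w t ≤ m)
    (harc : ∀ t ∈ arc w j, sumTranslates ν K J w t ≤ m') :
    ∃ y ∈ closedSimplex n, ∃ c < m, ∀ t, sumTranslates ν K J y t ≤ (c : EReal) := by
  by_cases hall : ∀ i, w i = w j
  · have hj : (j : ℕ) + 1 < n := lt_of_le_of_ne j.2 fun h => hcase ⟨hall, h⟩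
    -- All nodes coincide and arc j is a single point. Lifting node 0 one period below the others
    -- makes that point the arc to be shrunk, with the whole circle between the clusters.
    set x : Fin n → ℝ := fun i => if i = 0 then rep (w j) else rep (w j) + 1 with hx
    have hxw : (fun i => (x i : UnitAddCircle)) = w := by
      funext i
      rw [hx, hall i]
      dsimp only
      split_ifs
      · rw [coe_rep]
      · rw [AddCircle.coe_add, AddCircle.coe_period, add_zero, coe_rep]
    have hx0 : x 0 = rep (w j) := if_pos rfl
    have hx1 : x ⟨j + 1, hj⟩ = rep (w j) + 1 := if_neg fun h => by
      simpa using congrArg Fin.val h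
    have hlow : ∀ i, x 0 ≤ x i := fun i => by
      rw [hx0, hx]; dsimp only; split_ifs <;> linarith
    have hup : ∀ i, x i ≤ x ⟨j + 1, hj⟩ := fun i => by
      rw [hx1, hx]; dsimp only; split_ifs <;> linarith
    have hmono : Monotone x := fun i k hik => by
      by_cases hi : i = 0
      · rw [hi]; exact hlow k
      · have hk : k ≠ 0 := fun h => hi (le_antisymm (h ▸ hik) (Fin.zero_le i))
        simp [hx, hi, hk]
    refine exists_closedSimplex_bound_lt hν hK hsing hconc hper hJ hmono hlow hup
      (by linarith) (by linarith) hm (by rwa [hxw]) fun t ht => ?_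
    have ht' : t = rep (w j) + 1 := by
      rw [hx0, hx1] at ht
      exact le_antisymm ht.2 ht.1
    rw [hxw, ht', AddCircle.coe_add, AddCircle.coe_period, add_zero, coe_rep]
    exact harc _ (mem_arc w j)
  -- Relabelling by j + 1 makes arc j the one from the last lifted node to the first node plus a
  -- period.
  · set σ : Fin n ≃ Fin n := Equiv.addRight (j + 1) with hσ
    obtain ⟨x, hxw, hx, hx1⟩ := closedSimplex_rotate hw (j + 1)
    replace hxw : ∀ i, (x i : UnitAddCircle) = w (i + (j + 1)) := hxw
    have hxw' : (fun i => (x i : UnitAddCircle)) = w ∘ σ := funext hxw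
    have hF : ∀ t, sumTranslates (ν ∘ σ) K J (fun i => (x i : UnitAddCircle)) t =
        sumTranslates ν K J w t := fun t => by rw [hxw', sumTranslates_comp_equiv]
    obtain ⟨l, hl, hl1⟩ : ∃ l : Fin n, (∀ i, i ≤ l) ∧ l + (j + 1) = j := by
      have hn := NeZero.pos n
      refine ⟨⟨n - 1, by omega⟩, fun i => Fin.le_def.2 (by have := i.2; simp only; omega), ?_⟩
      have : (⟨n - 1, by omega⟩ : Fin n) + 1 = 0 := by
        ext
        simp [Fin.val_add, Nat.sub_add_cancel hn]
      rw [add_comm j 1, ← add_assoc, this, zero_add]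
    have hlt : x 0 < x l := by
      refine lt_of_le_of_ne (hx (Fin.zero_le l)) fun h => hall fun i => ?_
      have hc : ∀ k, w (k + (j + 1)) = (x 0 : UnitAddCircle) := fun k => by
        rw [← hxw k, le_antisymm (h ▸ hx (hl k)) (hx (Fin.zero_le k))]
      have h1 := hc (i - (j + 1))
      have h2 := hc l
      rw [sub_add_cancel] at h1
      rw [hl1] at h2
      rw [h1, h2]
    have hwj : w j = (x l : UnitAddCircle) := by rw [hxw l, hl1]
    have hwj1 : w (j + 1) = (x 0 : UnitAddCircle) := by rw [hxw 0, zero_add]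
    obtain ⟨y, hy, c, hc, hyc⟩ := exists_closedSimplex_bound_lt (fun i => hν (σ i)) hK hsing hconc
      hper hJ hx (i₀ := 0) (i₁ := l) (fun i => hx (Fin.zero_le i)) (fun i => hx (hl i)) hlt
      (hx1 0 l) hm (ν := ν ∘ σ) (fun t => by rw [hF]; exact hmax t) (fun t ht => by
        rw [hF]
        refine harc _ ?_
        rw [arc, if_neg hcase, ccwArc, mem_ofPred_eq, hwj, hwj1, ← AddCircle.coe_sub,
          ← AddCircle.coe_sub]
        have e : ((x 0 - x l : ℝ) : UnitAddCircle) = ((x 0 + 1 - x l : ℝ) : UnitAddCircle) := by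
          rw [add_sub_right_comm, AddCircle.coe_add, AddCircle.coe_period, add_zero]
        have := ht.1
        have := ht.2
        rw [e, rep_coe ⟨by linarith, by linarith⟩, rep_coe ⟨by linarith, by linarith⟩]
        linarith)
    refine ⟨fun i => y (i + -(j + 1)), closedSimplex_rotate hy _, c, hc, fun t => ?_⟩
    rw [← sumTranslates_comp_equiv σ]
    convert hyc t using 2
    funext i
    exact congrArg y (add_neg_cancel_right i (j + 1))

lemma IsMinimaxPoint.arcMax_eq (hν : ∀ j, 0 < ν j) (hK : IsKernel K) (hsing : IsSingular K)
    (hconc : IsStrictlyConcave K) (hper : IsPeriodicKernel K) (hJ : IsField n J)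
    {w : Fin n → UnitAddCircle} (hw : IsMinimaxPoint ν K J w) (j : Fin n) :
    arcMax ν K J w j = torusMax ν K J w := by
  by_contra hne
  have hlt := lt_of_le_of_ne (arcMax_le_torusMax w j) hne
  obtain ⟨C, hC⟩ := hJ.bddAbove
  lift torusMax ν K J w to ℝ using
    ⟨torusMax_ne_top hν hK hsing hper hJ w, torusMax_ne_bot hJ w⟩ with m hm
  obtain ⟨m', h1, h2⟩ := EReal.lt_iff_exists_real_btwn.1 hlt
  obtain ⟨y, hy, c, hc, hyc⟩ := exists_bound_lt_of_arc_le hν hK hsing hconc hper hC hw.1 j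
    -- If all nodes coincide, the last arc is the whole torus and there is nothing to improve.
    (fun h => hlt.ne (by rw [hm, arcMax, arc, if_pos h, torusMax]; simp))
    (EReal.coe_lt_coe_iff.1 h2) (m := m)
    (fun t => by rw [hm]; exact le_iSup (fun t => sumTranslates ν K J w t) t)
    (fun t ht => (le_iSup₂ (f := fun t _ => sumTranslates ν K J w t) t ht).trans h1.le)
  have h3 : minimaxValue ν K J ≤ c := (iInf₂_le y hy).trans (iSup_le hyc)
  rw [← hw.2, ← hm, EReal.coe_le_coe_iff] at h3
  linarith

lemma arcMax_eq_bot (hν : ∀ j, 0 < ν j) (hsing : IsSingular K) (hJ : ∀ t, J t ≠ ⊤)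
    {y : Fin n → UnitAddCircle} {j : Fin n} (hcase : ¬ ((∀ i, y i = y j) ∧ (j : ℕ) + 1 = n))
    (h : y (j + 1) = y j) : arcMax ν K J y j = ⊥ := by
  rw [arcMax, arc, if_neg hcase, h, ccwArc_self]
  simp [sumTranslates_node hν hsing hJ]

lemma mem_openSimplex_of_arcMax_ne_bot (hν : ∀ j, 0 < ν j) (hsing : IsSingular K)
    (hJ : ∀ t, J t ≠ ⊤) {w : Fin n → UnitAddCircle} (hw : w ∈ closedSimplex n)
    (harc : ∀ j, arcMax ν K J w j ≠ ⊥) : w ∈ openSimplex n := by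
  obtain ⟨x, hxw, hx, hx1⟩ := hw
  have hstep : ∀ i k : Fin n, (i : ℕ) + 1 = k → w k ≠ w i := by
    intro i k hik h
    have hk : k = i + 1 := by
      have := k.2
      ext
      rw [Fin.val_add, Fin.val_one', Nat.add_mod_mod, Nat.mod_eq_of_lt (by omega), hik]
    refine harc i (arcMax_eq_bot hν hsing hJ (fun hc => ?_) (hk ▸ h))
    have := k.2
    have := hc.2
    omega
  have hmono : StrictMono x := by
    intro i j hij
    have hij' : (i : ℕ) < j := hij
    have hk : (i : ℕ) + 1 < n := by have := j.2; omega
    refine lt_of_lt_of_le (b := x ⟨i + 1, hk⟩) (lt_of_le_of_ne (hx (Fin.le_def.2 (by simp)))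
      fun h => hstep i ⟨i + 1, hk⟩ rfl ?_) (hx (Fin.le_def.2 (by simpa using hij')))
    rw [← hxw, ← hxw, h]
  refine ⟨x, hxw, hmono, fun i j => ?_⟩
  refine lt_of_le_of_ne (hx1 i j) fun h => ?_
  have hwij : w j = w i := by
    rw [← hxw, ← hxw, h, AddCircle.coe_add, AddCircle.coe_period, add_zero]
  -- A spread of exactly one period can occur only between the last and the first node: strict
  -- monotonicity would otherwise push another pair beyond it. Then arc j is degenerate.
  have hn : (j : ℕ) + 1 = n := by
    by_contra hne
    have hk : (j : ℕ) + 1 < n := lt_of_le_of_ne j.2 hne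
    have := hmono (a := j) (b := ⟨j + 1, hk⟩) (Fin.lt_def.2 (by simp))
    have := hx1 i ⟨j + 1, hk⟩
    linarith
  have hi : (i : ℕ) = 0 := by
    by_contra hne
    have hk : (i : ℕ) - 1 < n := by have := i.2; omega
    have := hmono (a := ⟨i - 1, hk⟩) (b := i) (Fin.lt_def.2 (show (i : ℕ) - 1 < i by omega))
    have := hx1 ⟨i - 1, hk⟩ j
    linarith
  have hij : (i : ℕ) < j := by
    by_contra hle
    have : x j ≤ x i := hx (Fin.le_def.2 (not_lt.1 hle))
    linarith
  have hj1 : j + 1 = i := by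
    ext
    rw [Fin.val_add, Fin.val_one', Nat.add_mod_mod, hn, Nat.mod_self, hi]
  refine harc j (arcMax_eq_bot hν hsing hJ (fun hc => ?_) (by rw [hj1, hwij]))
  have hk : (i : ℕ) + 1 < n := by have := j.2; omega
  exact hstep i ⟨i + 1, hk⟩ rfl (by rw [hc.1, hc.1 i])

end Arcs

end SumOfTranslates

theorem mainTheorem2 (n : ℕ) [NeZero n] (ν : Fin n → ℝ) (hν : ∀ j, 0 < ν j)
    (K : ℝ → ℝ) (hK : SumOfTranslates.IsKernel K) (hsing : SumOfTranslates.IsSingular K)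
    (hconc : SumOfTranslates.IsStrictlyConcave K) (hper : SumOfTranslates.IsPeriodicKernel K)
    (J : UnitAddCircle → EReal) (hJ : SumOfTranslates.IsField n J) :
    (∃ w : Fin n → UnitAddCircle, SumOfTranslates.IsMinimaxPoint ν K J w) ∧
      ∀ w : Fin n → UnitAddCircle, SumOfTranslates.IsMinimaxPoint ν K J w →
        w ∈ SumOfTranslates.openSimplex n ∧
          SumOfTranslates.IsEquioscillationPoint ν K J w := by
  obtain ⟨C, hC⟩ := hJ.bddAbove
  have hJtop : ∀ t, J t ≠ ⊤ := fun t => ((hC t).trans_lt (EReal.coe_lt_top C)).ne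
  refine ⟨SumOfTranslates.exists_isMinimaxPoint hν hK hsing hper hJtop, fun w hw => ?_⟩
  have harc := hw.arcMax_eq hν hK hsing hconc hper hJ
  refine ⟨SumOfTranslates.mem_openSimplex_of_arcMax_ne_bot hν hsing hJtop hw.1 fun j => ?_,
    fun i j => (harc i).trans (harc j).symm⟩
  rw [harc j]
  exact SumOfTranslates.torusMax_ne_bot hJ w
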